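/- Theorem (Necessary optimality condition). Let $p,q,m,r$ be integers with $m\ge 0$ and $1\le r<\min\{p,q\}$, let $\beta>0$, and let $A_1,\dots,A_m\in\mathbb{R}^{(p+1)\times q}$ (for training data $X_i\in\mathbb{R}^{p\times q}$, $y_i\in\{-1,1\}$ and a standard basis vector $e_j\in\mathbb{R}^q$, these are $A_i=-y_i\begin{bmatrix}X_i\\ e_j^\top\end{bmatrix}$). With $\langle W,Y\rangle=\operatorname{tr}(W^\top Y)$, put $\mathscr{A}(\hat W)=(\langle A_1,\hat W\rangle,\dots,\langle A_m,\hat W\rangle)^\top$, let $\|z_+\|_0$ be the number of positive entries of $z\in\mathbb{R}^m$, and consider $$\min_{\hat W\in\mathbb{R}^{(p+1)\times q},\,z\in\mathbb{R}^m}\ \tfrac12\langle\hat W,\hat W\rangle+\beta\|z_+\|_0\quad\text{s.t.}\quad \mathbf 1+\mathscr{A}(\hat W)=z,\quad \operatorname{rank}(\hat W)\le r,\qquad (\ast)$$ with feasible region $\mathcal F$ and Lagrangian $\mathscr L(\hat W,z,\lambda)=\tfrac12\langle\hat W,\hat W\rangle+\beta\|z_+\|_0+\langle\lambda,\mathbf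 1+\mathscr A(\hat W)-z\rangle$, $\lambda\in\mathbb{R}^m$. On $\mathbb{R}^{(p+1)\times q}\times\mathbb{R}^m$ with its Euclidean inner product, the regular subdifferential $\partial g(x)$ of a real-valued function $g$ is the set of $v$ with $g(y)\ge g(x)+\langle v,y-x\rangle-o(\|y-x\|)$ as $y\to x$, and the regular normal cone $\mathrm N_S(x)$ of a set $S$ at $x\in S$ is the set of $v$ with $\langle v,y-x\rangle\le o(\|y-x\|)$ as $y\to x$, $y\in S$. A point $(\hat W,z)$ is a KKT point of $(\ast)$ if there is $\lambda\in\mathbb{R}^m$ such that $$-\partial_{(\hat W,z)}\mathscr L(\hat W,z,\lambda)\cap\mathrm N_{\mathcal F}(\hat W,z)\neq\emptyset,\qquad \operatorname{rank}(\hat W)\le r,\qquad \mathbf 1+\mathscr A(\hat W)-z=0.$$ Let $(\hat W,z)$ be a local minimizer of $(\ast)$, and let $\hat W=U\Sigma V^\top$ be a singular value decomposition with $U\in\mathbb{R}^{(p+1)\times(p+1)}$ and $V\in\mathbb{R}^{q\times q}$ orthogonal. Let $\Gamma$ be the index set of the nonzero singular values, let $\Gamma_p^\perp=\{1,\dots,p+1\}\setminus\Gamma$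 and $\Gamma_q^\perp=\{1,\dots,q\}\setminus\Gamma$, and let $U_I,V_I$ denote the submatrices of the columns indexed by $I$. For $i=1,\dots,m$ put $$T^i=\begin{bmatrix}U_\Gamma^\top A_iV_\Gamma & U_\Gamma^\top A_iV_{\Gamma_q^\perp}\\ U_{\Gamma_p^\perp}^\top A_iV_\Gamma & O\end{bmatrix},\qquad R^i=U^\top A_iV_\Gamma .$$ Assume that $T^1,\dots,T^m$ are linearly independent if $\operatorname{rank}(\hat W)=r$, and that $R^1,\dots,R^m$ are linearly independent if $\operatorname{rank}(\hat W)<r$. Then $(\hat W,z)$ is a KKT point of $(\ast)$. -/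

import Mathlib

open scoped Topology

namespace HLSMM

/-- Frobenius inner product `⟨W, Y⟩ = tr (Wᵀ Y)`. -/
noncomputable def frobInner {n q : ℕ} (W Y : Matrix (Fin n) (Fin q) ℝ) : ℝ :=
  (W.transpose * Y).trace

/-- The linear operator `𝒜(W) = (⟨A₁, W⟩, …, ⟨Aₘ, W⟩)`. -/
noncomputable def opA {n q m : ℕ} (A : Fin m → Matrix (Fin n) (Fin q) ℝ)
    (W : Matrix (Fin n) (Fin q) ℝ) : Fin m → ℝ :=
  fun i => frobInner (A i) W

/-- The scalar loss: `1` at positive arguments, `0` elsewhere. -/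
noncomputable def ell01 (t : ℝ) : ℝ := if 0 < t then 1 else 0

/-- The Heaviside loss `‖z₊‖₀`, the number of positive entries of `z`. -/
noncomputable def heavisideLoss {m : ℕ} (z : Fin m → ℝ) : ℝ := ∑ i, ell01 (z i)

/-- The space of pairs `(W, z)`; its (product) topology is the Euclidean one. -/
abbrev Pt (n q m : ℕ) : Type := Matrix (Fin n) (Fin q) ℝ × (Fin m → ℝ)

/-- The Euclidean inner product `⟨W, W'⟩ + ⟨z, z'⟩` on pairs. -/
noncomputable def pairInner {n q m : ℕ} (x y : Pt n q m) : ℝ :=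
  frobInner x.1 y.1 + x.2 ⬝ᵥ y.2

/-- The Euclidean norm on pairs. -/
noncomputable def pairNorm {n q m : ℕ} (x : Pt n q m) : ℝ := Real.sqrt (pairInner x x)

/-- The affine set `ℒ = {(W, z) | 1 + 𝒜(W) = z}`. -/
def affineSet {n q m : ℕ} (A : Fin m → Matrix (Fin n) (Fin q) ℝ) : Set (Pt n q m) :=
  {x | 1 + opA A x.1 = x.2}

/-- The set `ℛ = {W | rank W ≤ r}`. -/
def rankSet (n q r : ℕ) : Set (Matrix (Fin n) (Fin q) ℝ) := {W | W.rank ≤ r}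

/-- The feasible region `ℱ = ℒ ∩ ℛ`, where `ℛ` constrains the matrix component. -/
def feasibleSet {n q m : ℕ} (A : Fin m → Matrix (Fin n) (Fin q) ℝ) (r : ℕ) : Set (Pt n q m) :=
  affineSet A ∩ {x | x.1 ∈ rankSet n q r}

/-- The objective `½⟨W, W⟩ + β‖z₊‖₀`. -/
noncomputable def objective {n q m : ℕ} (β : ℝ) (x : Pt n q m) : ℝ :=
  (1 / 2) * frobInner x.1 x.1 + β * heavisideLoss x.2

/-- Local minimizers of `½⟨W, W⟩ + β‖z₊‖₀` subject to `1 + 𝒜(W) = z` and `rank W ≤ r`. -/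
def IsLocalMinimizer {n q m : ℕ} (A : Fin m → Matrix (Fin n) (Fin q) ℝ) (β : ℝ) (r : ℕ)
    (x : Pt n q m) : Prop :=
  x ∈ feasibleSet A r ∧ IsLocalMinOn (objective β) (feasibleSet A r) x

/-- The Lagrangian `½⟨W, W⟩ + β‖z₊‖₀ + ⟨lam, 1 + 𝒜(W) - z⟩`. -/
noncomputable def lagrangian {n q m : ℕ} (A : Fin m → Matrix (Fin n) (Fin q) ℝ) (β : ℝ)
    (lam : Fin m → ℝ) (x : Pt n q m) : ℝ :=
  (1 / 2) * frobInner x.1 x.1 + β * heavisideLoss x.2 + lam ⬝ᵥ (1 + opA A x.1 - x.2)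

/-- The regular (Fréchet) subdifferential of `g` at `x`: all `v` with
`g y ≥ g x + ⟨v, y - x⟩ - o(‖y - x‖)` as `y → x`. -/
def regularSubdifferential {n q m : ℕ} (g : Pt n q m → ℝ) (x : Pt n q m) : Set (Pt n q m) :=
  {v | ∀ ε : ℝ, 0 < ε →
    ∀ᶠ y in 𝓝 x, g x + pairInner v (y - x) - ε * pairNorm (y - x) ≤ g y}

/-- The regular (Fréchet) normal cone to `S` at `x ∈ S`: all `v` with
`⟨v, y - x⟩ ≤ o(‖y - x‖)` as `y → x` in `S`; it is empty when `x ∉ S`. -/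
def regularNormalCone {n q m : ℕ} (S : Set (Pt n q m)) (x : Pt n q m) : Set (Pt n q m) :=
  {v | x ∈ S ∧ ∀ ε : ℝ, 0 < ε →
    ∀ᶠ y in 𝓝[S] x, pairInner v (y - x) ≤ ε * pairNorm (y - x)}

/-- KKT points: for some multiplier, minus a regular subgradient of the Lagrangian in `(W, z)`
lies in the regular normal cone of the feasible region, and the point is feasible. -/
def IsKKTPoint {n q m : ℕ} (A : Fin m → Matrix (Fin n) (Fin q) ℝ) (β : ℝ) (r : ℕ)
    (x : Pt n q m) : Prop :=
  ∃ lam : Fin m → ℝ,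
    (∃ v ∈ regularSubdifferential (lagrangian A β lam) x,
      -v ∈ regularNormalCone (feasibleSet A r) x) ∧
    x.1.rank ≤ r ∧
    1 + opA A x.1 - x.2 = 0

/-- The rectangular `n × q` diagonal matrix with diagonal `σ`. -/
def rectDiagonal {n q : ℕ} (σ : Fin (min n q) → ℝ) : Matrix (Fin n) (Fin q) ℝ :=
  Matrix.of fun i j =>
    if h : (i : ℕ) = (j : ℕ) then
      σ ⟨(i : ℕ), lt_min i.isLt (lt_of_eq_of_lt h j.isLt)⟩
    else 0

/-- `W = U Σ Vᵀ` is a singular value decomposition: `U`, `V` orthogonal, `Σ` rectangular diagonal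
with nonnegative nonincreasing diagonal `σ`. -/
structure IsSVD {n q : ℕ} (W : Matrix (Fin n) (Fin q) ℝ) (U : Matrix (Fin n) (Fin n) ℝ)
    (σ : Fin (min n q) → ℝ) (V : Matrix (Fin q) (Fin q) ℝ) : Prop where
  orthogonal_left : U ∈ Matrix.orthogonalGroup (Fin n) ℝ
  orthogonal_right : V ∈ Matrix.orthogonalGroup (Fin q) ℝ
  nonneg : ∀ k, 0 ≤ σ k
  antitone : Antitone σ
  eq_mul : W = U * rectDiagonal σ * V.transpose

/-- The index set `Γ` of the nonzero singular values. -/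
abbrev Gam {n q : ℕ} (σ : Fin (min n q) → ℝ) : Type := {k : Fin (min n q) // σ k ≠ 0}

/-- The complement of `Γ` among the `n` row indices. -/
abbrev GamRowCompl {n q : ℕ} (σ : Fin (min n q) → ℝ) : Type :=
  {i : Fin n // ∀ k : Gam σ, Fin.castLE (min_le_left n q) k.1 ≠ i}

/-- The complement of `Γ` among the `q` column indices. -/
abbrev GamColCompl {n q : ℕ} (σ : Fin (min n q) → ℝ) : Type :=
  {j : Fin q // ∀ k : Gam σ, Fin.castLE (min_le_right n q) k.1 ≠ j}

/-- The columns of `U` indexed by `Γ`. -/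
def leftGam {n q : ℕ} (U : Matrix (Fin n) (Fin n) ℝ) (σ : Fin (min n q) → ℝ) :
    Matrix (Fin n) (Gam σ) ℝ :=
  U.submatrix id fun k => Fin.castLE (min_le_left n q) k.1

/-- The columns of `U` indexed by the complement of `Γ`. -/
def leftCompl {n q : ℕ} (U : Matrix (Fin n) (Fin n) ℝ) (σ : Fin (min n q) → ℝ) :
    Matrix (Fin n) (GamRowCompl σ) ℝ :=
  U.submatrix id fun i => i.1

/-- The columns of `V` indexed by `Γ`. -/
def rightGam {n q : ℕ} (V : Matrix (Fin q) (Fin q) ℝ) (σ : Fin (min n q) → ℝ) :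
    Matrix (Fin q) (Gam σ) ℝ :=
  V.submatrix id fun k => Fin.castLE (min_le_right n q) k.1

/-- The columns of `V` indexed by the complement of `Γ`. -/
def rightCompl {n q : ℕ} (V : Matrix (Fin q) (Fin q) ℝ) (σ : Fin (min n q) → ℝ) :
    Matrix (Fin q) (GamColCompl σ) ℝ :=
  V.submatrix id fun j => j.1

/-- The block matrix `T = [U_Γᵀ A V_Γ, U_Γᵀ A V_Γ⊥; U_Γ⊥ᵀ A V_Γ, 0]`. -/
noncomputable def matT {n q : ℕ} (U : Matrix (Fin n) (Fin n) ℝ) (σ : Fin (min n q) → ℝ)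
    (V : Matrix (Fin q) (Fin q) ℝ) (A : Matrix (Fin n) (Fin q) ℝ) :
    Matrix (Gam σ ⊕ GamRowCompl σ) (Gam σ ⊕ GamColCompl σ) ℝ :=
  Matrix.fromBlocks
    ((leftGam U σ).transpose * A * rightGam V σ)
    ((leftGam U σ).transpose * A * rightCompl V σ)
    ((leftCompl U σ).transpose * A * rightGam V σ)
    0

/-- The matrix `R = Uᵀ A V_Γ`. -/
noncomputable def matR {n q : ℕ} (U : Matrix (Fin n) (Fin n) ℝ) (σ : Fin (min n q) → ℝ)
    (V : Matrix (Fin q) (Fin q) ℝ) (A : Matrix (Fin n) (Fin q) ℝ) :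
    Matrix (Fin n) (Gam σ) ℝ :=
  U.transpose * A * rightGam V σ

/-- The constraint qualification at `W`, expressed through a singular value decomposition of `W`:
the `T` matrices are linearly independent if `rank W = r`, the `R` matrices if `rank W < r`. -/
def ConstraintQualification {n q m : ℕ} (A : Fin m → Matrix (Fin n) (Fin q) ℝ) (r : ℕ)
    (W : Matrix (Fin n) (Fin q) ℝ) (U : Matrix (Fin n) (Fin n) ℝ)
    (σ : Fin (min n q) → ℝ) (V : Matrix (Fin q) (Fin q) ℝ) : Prop :=
  (W.rank = r → LinearIndependent ℝ fun i => matT U σ V (A i)) ∧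
  (W.rank < r → LinearIndependent ℝ fun i => matR U σ V (A i))

end HLSMM

/-!
Eliminating `z = 1 + 𝒜(W)` and noting that the Heaviside loss near `z` can only change through the
zero entries of `z`, a local minimizer `W` locally minimizes `½⟨X, X⟩` over the matrices of rank at
most `r` with `⟨Aᵢ, X⟩ ≤ ⟨Aᵢ, W⟩` whenever `zᵢ = 0`. The arcs `(1 + t X) W (1 + t Y)`, and
`(1 + t X) W + t K` with `rank W + rank K ≤ r`, respect the rank bound, and the constraint
qualification says that the functionals `⟨Aᵢ, ·⟩` are linearly independent on their velocities.
Hence linear programming duality, which is elementary for independent functionals, yields `s ≥ 0`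
supported on the zeros of `z` such that `N = W + ∑ sᵢ Aᵢ` is orthogonal to the velocities. Every
such `s` is a regular subgradient of `β‖·₊‖₀` at `z`, so it remains to see that `-N` is normal to
the matrices of rank at most `r`.

If `rank W = r`, then `N` annihilates all `X W` and `W Y`. Near `W`, a matrix `X` of rank at most
`r` satisfies `X M(X) X = X` with `M` continuous, so `X - W` agrees with the second-order term
`(X - W) M(X) (X - W)` up to such matrices. If `rank W < r`, each rank-one `K` comes with its own
multiplier, and these all agree because the functionals are already independent on the matrices
`X W`; hence `N = 0`.
-/

namespace HLSMM

section LinearProgramming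

variable {K E ι : Type*} [AddCommGroup E]

theorem exists_dual_family [Field K] [Module K E] [Finite ι] [DecidableEq ι]
    {a : ι → Module.Dual K E} (ha : LinearIndependent K a) :
    ∃ e : ι → E, ∀ i j, a i (e j) = if i = j then 1 else 0 := by
  have hsep : ∀ j, ∃ x, (∀ i ≠ j, a i x = 0) ∧ a j x ≠ 0 := by
    intro j
    by_contra! hker
    refine ha.notMem_span_image (s := {i | i ≠ j}) (x := j) (by simp) ?_
    rw [Set.image_eq_range]
    refine mem_span_of_iInf_ker_le_ker fun x hx => hker x fun i hi => ?_
    simpa using (Submodule.mem_iInf _).1 hx ⟨i, hi⟩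
  choose x hx hx' using hsep
  refine ⟨fun j => (a j (x j))⁻¹ • x j, fun i j => ?_⟩
  rcases eq_or_ne i j with rfl | hij
  · simp [hx']
  · simp [hx j i hij, hij]

variable [Field K] [LinearOrder K] [IsStrictOrderedRing K] [Module K E]
  {a : ι → Module.Dual K E} {w : Module.Dual K E} {I : Set ι}

theorem nonneg_of_nonpos_of_nonneg_of_neg [Finite ι] (ha : LinearIndependent K a)
    (h : ∀ x, (∀ i ∈ I, a i x < 0) → 0 ≤ w x) {x : E} (hx : ∀ i ∈ I, a i x ≤ 0) : 0 ≤ w x := by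
  classical
  have := Fintype.ofFinite ι
  obtain ⟨e, he⟩ := exists_dual_family ha
  have hsum : ∀ i, a i (∑ j, e j) = 1 := by simp [he]
  refine le_of_forall_pos_le_add fun ε hε => ?_
  set δ := ε / (|w (∑ j, e j)| + 1) with hδ
  have hδ0 : 0 < δ := by positivity
  have hperturb : 0 ≤ w (x - δ • ∑ j, e j) := h _ fun i hi => by
    rw [map_sub, map_smul, hsum, smul_eq_mul]
    linarith [hx i hi]
  have hbound : δ * |w (∑ j, e j)| ≤ ε := by
    rw [hδ, div_mul_eq_mul_div, div_le_iff₀ (by positivity)]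
    linarith
  rw [map_sub, map_smul, smul_eq_mul] at hperturb
  linarith [mul_le_mul_of_nonneg_left (neg_abs_le (w (∑ j, e j))) hδ0.le]

theorem exists_nonneg_add_sum_smul_eq_zero [Fintype ι] (ha : LinearIndependent K a)
    (h : ∀ x, (∀ i ∈ I, a i x < 0) → 0 ≤ w x) :
    ∃ s : ι → K, 0 ≤ s ∧ (∀ i ∉ I, s i = 0) ∧ w + ∑ i, s i • a i = 0 := by
  classical
  obtain ⟨e, he⟩ := exists_dual_family ha
  have hw : ∀ x, (∀ i ∈ I, a i x ≤ 0) → 0 ≤ w x := fun x =>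
    nonneg_of_nonpos_of_nonneg_of_neg ha h
  have hle : ∀ j, w (e j) ≤ 0 := fun j => by
    simpa using hw (-e j) fun i _ => by rw [map_neg, he]; split_ifs <;> simp
  refine ⟨fun j => -w (e j), fun j => neg_nonneg.2 (hle j), fun j hj => ?_, ?_⟩
  · have hge : 0 ≤ w (e j) := hw _ fun i hi => by
      rw [he, if_neg (ne_of_mem_of_not_mem hi hj)]
    exact neg_eq_zero.2 ((hle j).antisymm hge)
  · ext x
    set y := x - ∑ j, a j x • e j with hy
    have hay : ∀ i, a i y = 0 := fun i => by simp [hy, he]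
    have hwy : w y = 0 := le_antisymm
      (by simpa using hw (-y) fun i _ => by simp [hay]) (hw y fun i _ => (hay i).le)
    simpa [hy, sub_eq_add_neg, mul_comm] using hwy

end LinearProgramming

section Matrix

open Matrix

variable {K m n : Type*} [Field K] [Fintype n]

theorem rank_add_le (X Y : Matrix m n K) : (X + Y).rank ≤ X.rank + Y.rank := by
  unfold Matrix.rank
  rw [mulVecLin_add]
  exact (Submodule.finrank_mono (LinearMap.range_add_le _ _)).trans
    (Submodule.finrank_add_le_finrank_add_finrank _ _)

theorem rank_smul_le (c : K) (X : Matrix m n K) : (c • X).rank ≤ X.rank := by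
  classical
  simpa using rank_mul_le_left X (c • (1 : Matrix n n K))

theorem exists_mul_mul_eq_one [Fintype m] (X : Matrix m n K) :
    ∃ (L : Matrix (Fin X.rank) m K) (R : Matrix n (Fin X.rank) K), L * X * R = 1 := by
  classical
  set f := X.toLin'
  obtain ⟨g, hg⟩ := f.rangeRestrict.exists_rightInverse_of_surjective f.range_rangeRestrict
  obtain ⟨π, hπ⟩ := f.range.subtype.exists_leftInverse_of_injective f.range.ker_subtype
  have hfin : Module.finrank K f.range = X.rank := rfl
  let e := (Module.finBasisOfFinrankEq K f.range hfin).equivFun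
  refine ⟨(e ∘ₗ π).toMatrix', (g ∘ₗ e.symm).toMatrix', toLin'.injective (LinearMap.ext fun v => ?_)⟩
  have hfg : f (g (e.symm v)) = e.symm v := congrArg Subtype.val (LinearMap.congr_fun hg _)
  have hπe : π (e.symm v : m → K) = e.symm v := LinearMap.congr_fun hπ _
  simp [toLin'_mul, f, hfg, hπe]

theorem mul_inv_mul_eq_of_rank_le [Fintype m] {ι : Type*} [Fintype ι] [DecidableEq ι]
    {X : Matrix m n K} {L : Matrix ι m K} {R : Matrix n ι K} (hdet : IsUnit (L * X * R).det)
    (hrank : X.rank ≤ Fintype.card ι) : X * (R * (L * X * R)⁻¹ * L) * X = X := by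
  have hcard : Fintype.card ι ≤ (X * R).rank := by
    rw [← rank_of_isUnit _ ((isUnit_iff_isUnit_det _).2 hdet), Matrix.mul_assoc]
    exact rank_mul_le_right _ _
  have hle : (X * R).mulVecLin.range ≤ X.mulVecLin.range := by
    rw [mulVecLin_mul]
    exact LinearMap.range_comp_le_range _ _
  have hrange : (X * R).mulVecLin.range = X.mulVecLin.range :=
    Submodule.eq_of_le_of_finrank_le hle (hrank.trans hcard)
  have hcol : ∀ j, ∃ u, (X * R) *ᵥ u = X.col j := fun j => by
    have hmem : X.col j ∈ X.mulVecLin.range := by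
      rw [range_mulVecLin]
      exact Submodule.subset_span ⟨j, rfl⟩
    rwa [← hrange] at hmem
  choose u hu using hcol
  set T : Matrix ι n K := (of u)ᵀ
  have hT : X * R * T = X := ext fun i j => congrFun (hu j) i
  calc X * (R * (L * X * R)⁻¹ * L) * X
      = X * (R * (L * X * R)⁻¹ * L) * (X * R * T) := by rw [hT]
    _ = X * R * ((L * X * R)⁻¹ * (L * X * R)) * T := by simp only [Matrix.mul_assoc]
    _ = X := by rw [nonsing_inv_mul _ hdet, Matrix.mul_one, hT]

theorem exists_continuousAt_mul_mul_eq_self [Fintype m] [TopologicalSpace K]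
    [IsTopologicalDivisionRing K] [T1Space K] (W : Matrix m n K) :
    ∃ M : Matrix m n K → Matrix n m K, ContinuousAt M W ∧
      ∀ᶠ X in 𝓝 W, X.rank ≤ W.rank → X * M X * X = X := by
  obtain ⟨L, R, hLR⟩ := exists_mul_mul_eq_one W
  have hC : Continuous fun X : Matrix m n K => L * X * R := by fun_prop
  have hdet : (L * W * R).det ≠ 0 := by simp [hLR]
  have hinv : ContinuousAt (fun X : Matrix m n K => (L * X * R)⁻¹) W := by
    refine (continuousAt_matrix_inv _ ?_).comp hC.continuousAt
    rw [Ring.inverse_eq_inv']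
    exact continuousAt_inv₀ hdet
  refine ⟨fun X => R * (L * X * R)⁻¹ * L, by fun_prop, ?_⟩
  filter_upwards [hC.matrix_det.continuousAt.eventually_ne hdet] with X hX hrank
  exact mul_inv_mul_eq_of_rank_le hX.isUnit (by simpa using hrank)

end Matrix

section LinearIndependence

variable {R ι E F G : Type*} [Ring R] [AddCommGroup E] [AddCommGroup F] [AddCommGroup G]
  [Module R E] [Module R F] [Module R G]

theorem linearIndependent_comp_of_ker_le {f : E →ₗ[R] F} {g : E →ₗ[R] G} {v : ι → E}
    (hg : LinearIndependent R fun i => g (v i)) (h : f.ker ≤ g.ker) :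
    LinearIndependent R fun i => f (v i) := by
  rw [linearIndependent_iff] at hg ⊢
  refine fun c hc => hg c ?_
  have hker : Finsupp.linearCombination R v c ∈ f.ker := by
    rwa [LinearMap.mem_ker, Finsupp.apply_linearCombination]
  rw [← h hker, Finsupp.apply_linearCombination]
  rfl

end LinearIndependence

section Frobenius

open Matrix

variable {n q k : ℕ}

/-- The Frobenius inner product as a bilinear form, which makes the linear algebra of dual spaces
available for `frobInner`. -/
noncomputable def frobForm : LinearMap.BilinForm ℝ (Matrix (Fin n) (Fin q) ℝ) :=
  LinearMap.mk₂ ℝ frobInner (by simp [frobInner, Matrix.add_mul]) (by simp [frobInner])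
    (by simp [frobInner, Matrix.mul_add]) (by simp [frobInner])

@[simp]
theorem frobForm_apply (W Y : Matrix (Fin n) (Fin q) ℝ) : frobForm W Y = frobInner W Y := rfl

theorem frobInner_zero_left (W : Matrix (Fin n) (Fin q) ℝ) : frobInner 0 W = 0 :=
  LinearMap.map_zero₂ frobForm W

theorem frobInner_add_left (X Y W : Matrix (Fin n) (Fin q) ℝ) :
    frobInner (X + Y) W = frobInner X W + frobInner Y W := LinearMap.map_add₂ frobForm X Y W

theorem frobInner_add_right (W X Y : Matrix (Fin n) (Fin q) ℝ) :
    frobInner W (X + Y) = frobInner W X + frobInner W Y := map_add (frobForm W) X Y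

theorem frobInner_sub_left (X Y W : Matrix (Fin n) (Fin q) ℝ) :
    frobInner (X - Y) W = frobInner X W - frobInner Y W := LinearMap.map_sub₂ frobForm X Y W

theorem frobInner_sub_right (W X Y : Matrix (Fin n) (Fin q) ℝ) :
    frobInner W (X - Y) = frobInner W X - frobInner W Y := map_sub (frobForm W) X Y

theorem frobInner_smul_left (c : ℝ) (X W : Matrix (Fin n) (Fin q) ℝ) :
    frobInner (c • X) W = c * frobInner X W := LinearMap.map_smul₂ frobForm c X W

theorem frobInner_smul_right (c : ℝ) (W X : Matrix (Fin n) (Fin q) ℝ) :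
    frobInner W (c • X) = c * frobInner W X := map_smul (frobForm W) c X

theorem frobInner_eq_sum (W Y : Matrix (Fin n) (Fin q) ℝ) :
    frobInner W Y = ∑ i, ∑ j, W i j * Y i j := by
  simp only [frobInner, trace, diag, mul_apply, transpose_apply]
  exact Finset.sum_comm

theorem frobInner_comm (W Y : Matrix (Fin n) (Fin q) ℝ) : frobInner W Y = frobInner Y W := by
  simp only [frobInner_eq_sum, mul_comm]

theorem frobInner_self_nonneg (W : Matrix (Fin n) (Fin q) ℝ) : 0 ≤ frobInner W W := by
  rw [frobInner_eq_sum]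
  exact Finset.sum_nonneg fun i _ => Finset.sum_nonneg fun j _ => mul_self_nonneg _

theorem frobInner_single_right (W : Matrix (Fin n) (Fin q) ℝ) (i : Fin n) (j : Fin q) :
    frobInner W (single i j 1) = W i j := by
  simp [frobInner_eq_sum, single_apply, ite_and]

theorem eq_zero_of_forall_frobInner_eq_zero {W : Matrix (Fin n) (Fin q) ℝ}
    (h : ∀ X, frobInner W X = 0) : W = 0 := by
  ext i j
  simpa [frobInner_single_right] using h (single i j 1)

theorem frobInner_mul_eq_mul_transpose (B : Matrix (Fin n) (Fin q) ℝ)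
    (X : Matrix (Fin n) (Fin k) ℝ) (Y : Matrix (Fin k) (Fin q) ℝ) :
    frobInner B (X * Y) = frobInner (B * Yᵀ) X := by
  rw [frobInner, frobInner, transpose_mul, transpose_transpose, ← Matrix.mul_assoc,
    trace_mul_comm, ← Matrix.mul_assoc]

theorem frobInner_mul_eq_transpose_mul (B : Matrix (Fin n) (Fin q) ℝ)
    (X : Matrix (Fin n) (Fin k) ℝ) (Y : Matrix (Fin k) (Fin q) ℝ) :
    frobInner B (X * Y) = frobInner (Xᵀ * B) Y := by
  rw [frobInner, frobInner, transpose_mul, transpose_transpose, Matrix.mul_assoc]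

theorem frobInner_le_sqrt_mul_sqrt (W Y : Matrix (Fin n) (Fin q) ℝ) :
    frobInner W Y ≤ √(frobInner W W) * √(frobInner Y Y) := by
  simp only [frobInner_eq_sum, ← Fintype.sum_prod_type', ← pow_two]
  exact Real.sum_mul_le_sqrt_mul_sqrt _ _ _

@[fun_prop]
theorem continuous_frobInner {α : Type*} [TopologicalSpace α] {f g : α → Matrix (Fin n) (Fin q) ℝ}
    (hf : Continuous f) (hg : Continuous g) : Continuous fun a => frobInner (f a) (g a) := by
  unfold frobInner
  fun_prop

variable {m : ℕ} (A : Fin m → Matrix (Fin n) (Fin q) ℝ)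

theorem continuous_opA : Continuous (opA A) :=
  continuous_pi fun _ => continuous_frobInner continuous_const continuous_id

theorem dotProduct_opA (s : Fin m → ℝ) (X : Matrix (Fin n) (Fin q) ℝ) :
    s ⬝ᵥ opA A X = frobInner (∑ i, s i • A i) X := by
  simp [dotProduct, opA, ← frobForm_apply]

theorem sqrt_frobInner_le_pairNorm (x : Pt n q m) : √(frobInner x.1 x.1) ≤ pairNorm x :=
  Real.sqrt_le_sqrt <| le_add_of_nonneg_right <|
    Finset.sum_nonneg fun _ _ => mul_self_nonneg _

end Frobenius

section Heaviside

open Filter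

theorem ell01_of_pos {t : ℝ} (h : 0 < t) : ell01 t = 1 := if_pos h

theorem ell01_of_nonpos {t : ℝ} (h : t ≤ 0) : ell01 t = 0 := if_neg h.not_gt

theorem eventually_ell01_eq {t : ℝ} (ht : t ≠ 0) : ∀ᶠ u in 𝓝 t, ell01 u = ell01 t := by
  rcases ht.lt_or_gt with ht | ht
  · filter_upwards [eventually_lt_nhds ht] with u hu
    rw [ell01_of_nonpos hu.le, ell01_of_nonpos ht.le]
  · filter_upwards [eventually_gt_nhds ht] with u hu
    rw [ell01_of_pos hu, ell01_of_pos ht]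

variable {m : ℕ}

theorem eventually_forall_ell01_eq (z : Fin m → ℝ) :
    ∀ᶠ y in 𝓝 z, ∀ i, z i ≠ 0 → ell01 (y i) = ell01 (z i) :=
  eventually_all.2 fun i => eventually_imp_distrib_left.2 fun hi =>
    ((continuous_apply i).tendsto z).eventually (eventually_ell01_eq hi)

theorem eventually_heavisideLoss_le (z : Fin m → ℝ) :
    ∀ᶠ y in 𝓝 z, (∀ i, z i = 0 → y i ≤ 0) → heavisideLoss y ≤ heavisideLoss z := by
  filter_upwards [eventually_forall_ell01_eq z] with y hy hy0
  refine Finset.sum_le_sum fun i _ => ?_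
  rcases eq_or_ne (z i) 0 with hi | hi
  · rw [ell01_of_nonpos (hy0 i hi), ell01_of_nonpos hi.le]
  · exact (hy i hi).le

/-- The nonnegative vectors supported on the zero entries of `z`. For every `β > 0` these are the
regular subgradients of `β‖·₊‖₀` at `z`. -/
def heavisideSubgradients (z : Fin m → ℝ) : Set (Fin m → ℝ) :=
  {s | 0 ≤ s ∧ ∀ i, z i ≠ 0 → s i = 0}

theorem eventually_add_dotProduct_le_heavisideLoss {β : ℝ} (hβ : 0 < β) {s z : Fin m → ℝ}
    (hs : s ∈ heavisideSubgradients z) :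
    ∀ᶠ y in 𝓝 z, β * heavisideLoss z + s ⬝ᵥ (y - z) ≤ β * heavisideLoss y := by
  have hlt : ∀ᶠ y in 𝓝 z, ∀ i, s i * (y i - z i) < β := by
    refine eventually_all.2 fun i => ?_
    have hcont : Continuous fun y : Fin m → ℝ => s i * (y i - z i) := by fun_prop
    exact hcont.continuousAt.eventually_lt continuousAt_const (by simpa using hβ)
  filter_upwards [hlt, eventually_forall_ell01_eq z] with y hyβ hy
  simp only [heavisideLoss, Finset.mul_sum, dotProduct, Pi.sub_apply, ← Finset.sum_add_distrib]
  refine Finset.sum_le_sum fun i _ => ?_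
  rcases eq_or_ne (z i) 0 with hi | hi
  · have hyi := hyβ i
    rw [hi, sub_zero] at hyi ⊢
    rw [ell01_of_nonpos le_rfl]
    rcases le_or_gt (y i) 0 with hyi' | hyi'
    · rw [ell01_of_nonpos hyi']
      linarith [mul_nonpos_of_nonneg_of_nonpos (hs.1 i) hyi']
    · rw [ell01_of_pos hyi']
      linarith
  · simp [hs.2 i hi, hy i hi]

end Heaviside

section Problem

open Filter

variable {n q m r : ℕ} {A : Fin m → Matrix (Fin n) (Fin q) ℝ} {β : ℝ}
  {W : Matrix (Fin n) (Fin q) ℝ} {z : Fin m → ℝ}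

theorem mem_regularSubdifferential_lagrangian (hβ : 0 < β) {s : Fin m → ℝ}
    (hs : s ∈ heavisideSubgradients z) :
    (W + ∑ i, s i • A i, 0) ∈ regularSubdifferential (lagrangian A β s) (W, z) := by
  intro ε hε
  filter_upwards [(continuous_snd.tendsto (W, z)).eventually
    (eventually_add_dotProduct_le_heavisideLoss hβ hs)] with ⟨X, y⟩ hy
  have hquad : frobInner W W / 2 + frobInner W (X - W) ≤ frobInner X X / 2 := by
    have hXW := frobInner_self_nonneg (X - W)
    simp only [frobInner_sub_left, frobInner_sub_right, frobInner_comm X W] at hXW ⊢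
    linarith
  have hnorm : 0 ≤ ε * pairNorm ((X, y) - (W, z)) := mul_nonneg hε.le (Real.sqrt_nonneg _)
  simp only [dotProduct_sub] at hy
  simp only [lagrangian, pairInner, dotProduct_sub, dotProduct_add, dotProduct_opA, Prod.fst_sub,
    zero_dotProduct, frobInner_add_left, frobInner_sub_right] at hquad ⊢
  linarith

theorem IsLocalMinimizer.isLocalMinOn_frobInner (hβ : 0 ≤ β)
    (hmin : IsLocalMinimizer A β r (W, z)) :
    IsLocalMinOn (fun X => frobInner X X)
      (rankSet n q r ∩ {X | ∀ i ∈ {i | z i = 0}, frobInner (A i) X ≤ frobInner (A i) W}) W := by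
  obtain ⟨⟨hz : 1 + opA A W = z, -⟩, hloc⟩ := hmin
  set C := rankSet n q r ∩ {X | ∀ i ∈ {i | z i = 0}, frobInner (A i) X ≤ frobInner (A i) W}
  have htend : Tendsto (fun X => 1 + opA A X) (𝓝[C] W) (𝓝 z) :=
    ((continuous_const.add (continuous_opA A)).tendsto' _ _ hz).mono_left nhdsWithin_le_nhds
  have hlift : Tendsto (fun X => (X, 1 + opA A X)) (𝓝[C] W) (𝓝[feasibleSet A r] (W, z)) :=
    tendsto_nhdsWithin_of_tendsto_nhds_of_eventually_within _
      ((tendsto_id.mono_left nhdsWithin_le_nhds).prodMk_nhds htend)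
      (eventually_mem_nhdsWithin.mono fun X hX => ⟨rfl, hX.1⟩)
  have hloss : ∀ᶠ X in 𝓝[C] W, heavisideLoss (1 + opA A X) ≤ heavisideLoss z := by
    filter_upwards [htend.eventually (eventually_heavisideLoss_le z), self_mem_nhdsWithin]
      with X hX hXC
    refine hX fun i hi => le_trans ?_ hi.le
    rw [← hz]
    exact add_le_add_right (hXC.2 i hi) 1
  filter_upwards [hlift.eventually hloc, hloss] with X hobj hX
  simp only [objective] at hobj
  linarith [mul_le_mul_of_nonneg_left hX hβ]

end Problem

section FirstOrder

open Filter

/-- The directions `H` for which some quadratic arc `t ↦ x + t • H + t ^ 2 • Q` stays in `C`: a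
supply of tangent directions to `C` at `x`. The second-order term is needed because the set of
matrices of bounded rank contains few line segments. -/
def arcDirections {E : Type*} [AddCommGroup E] [Module ℝ E] (C : Set E) (x : E) : Set E :=
  {H | ∃ Q : E, ∀ t : ℝ, x + t • H + t ^ 2 • Q ∈ C}

theorem eventually_mul_add_sq_mul_neg {b : ℝ} {g : ℝ → ℝ} (hg : ContinuousAt g 0) (hb : b < 0) :
    ∀ᶠ t in 𝓝[>] 0, t * b + t ^ 2 * g t < 0 := by
  have hneg : ∀ᶠ t in 𝓝[>] 0, b + t * g t < 0 :=
    nhdsWithin_le_nhds <| ContinuousAt.eventually_lt (by fun_prop) continuousAt_const (by simpa)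
  filter_upwards [hneg, self_mem_nhdsWithin] with t ht (ht0 : 0 < t)
  calc t * b + t ^ 2 * g t = t * (b + t * g t) := by ring
    _ < 0 := mul_neg_of_pos_of_neg ht0 ht

variable {n q : ℕ} {ι : Type*} {C : Set (Matrix (Fin n) (Fin q) ℝ)}
  {A : ι → Matrix (Fin n) (Fin q) ℝ} {I : Set ι} {W : Matrix (Fin n) (Fin q) ℝ}

theorem frobInner_nonneg_of_mem_arcDirections [Finite ι]
    (hmin : IsLocalMinOn (fun X => frobInner X X)
      (C ∩ {X | ∀ i ∈ I, frobInner (A i) X ≤ frobInner (A i) W}) W)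
    {H : Matrix (Fin n) (Fin q) ℝ} (hH : H ∈ arcDirections C W)
    (hneg : ∀ i ∈ I, frobInner (A i) H < 0) : 0 ≤ frobInner W H := by
  obtain ⟨Q, hQ⟩ := hH
  by_contra! hWH
  set γ : ℝ → Matrix (Fin n) (Fin q) ℝ := fun t => W + t • H + t ^ 2 • Q with hγ
  have hγ0 : Tendsto γ (𝓝[>] 0) (𝓝 W) :=
    (Continuous.tendsto' (by fun_prop) 0 W (by simp [hγ])).mono_left nhdsWithin_le_nhds
  have hconstr : ∀ᶠ t in 𝓝[>] 0, ∀ i ∈ I, frobInner (A i) (γ t) ≤ frobInner (A i) W := by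
    refine eventually_all.2 fun i => eventually_imp_distrib_left.2 fun hi => ?_
    filter_upwards [eventually_mul_add_sq_mul_neg (g := fun _ => frobInner (A i) Q)
      continuousAt_const (hneg i hi)] with t ht
    simp only [hγ, frobInner_add_right, frobInner_smul_right]
    linarith
  have hdecr : ∀ᶠ t in 𝓝[>] 0, frobInner (γ t) (γ t) < frobInner W W := by
    have hcont : ContinuousAt (fun t : ℝ => frobInner H H + 2 * frobInner W Q +
        t * (2 * frobInner H Q) + t ^ 2 * frobInner Q Q) 0 := by fun_prop
    filter_upwards [eventually_mul_add_sq_mul_neg hcont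
      (mul_neg_of_pos_of_neg two_pos hWH)] with t ht
    simp only [hγ, frobInner_add_right, frobInner_smul_right, frobInner_add_left,
      frobInner_smul_left, frobInner_comm H W, frobInner_comm Q W, frobInner_comm Q H]
    linarith
  have hmem : ∀ᶠ t in 𝓝[>] 0, frobInner W W ≤ frobInner (γ t) (γ t) :=
    (tendsto_nhdsWithin_of_tendsto_nhds_of_eventually_within γ hγ0
      (hconstr.mono fun t => And.intro (hQ t))).eventually hmin
  obtain ⟨t, hlt, hle⟩ := (hdecr.and hmem).exists
  exact hlt.not_ge hle

theorem exists_multiplier_of_isLocalMinOn [Fintype ι]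
    (hmin : IsLocalMinOn (fun X => frobInner X X)
      (C ∩ {X | ∀ i ∈ I, frobInner (A i) X ≤ frobInner (A i) W}) W)
    {S : Submodule ℝ (Matrix (Fin n) (Fin q) ℝ)} (hS : ↑S ⊆ arcDirections C W)
    (hA : LinearIndependent ℝ fun i => S.dualRestrict (frobForm (A i))) :
    ∃ s : ι → ℝ, 0 ≤ s ∧ (∀ i ∉ I, s i = 0) ∧
      S.dualRestrict (frobForm (W + ∑ i, s i • A i)) = 0 := by
  obtain ⟨s, hs, hsI, hsum⟩ := exists_nonneg_add_sum_smul_eq_zero (I := I)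
    (w := S.dualRestrict (frobForm W)) hA fun H =>
      frobInner_nonneg_of_mem_arcDirections hmin (hS H.2)
  exact ⟨s, hs, hsI, by simpa only [map_add, map_sum, map_smul] using hsum⟩

end FirstOrder

section RankSet

open Matrix Filter

variable {n q r : ℕ} {W N : Matrix (Fin n) (Fin q) ℝ}

theorem mul_add_mul_mem_arcDirections (hW : W ∈ rankSet n q r) (X : Matrix (Fin n) (Fin n) ℝ)
    (Y : Matrix (Fin q) (Fin q) ℝ) : X * W + W * Y ∈ arcDirections (rankSet n q r) W := by
  refine ⟨X * W * Y, fun t => ?_⟩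
  have hfactor : W + t • (X * W + W * Y) + t ^ 2 • (X * W * Y) =
      (1 + t • X) * W * (1 + t • Y) := by
    simp only [Matrix.add_mul, Matrix.mul_add, Matrix.one_mul, Matrix.mul_one, Matrix.smul_mul,
      Matrix.mul_smul, smul_add, smul_smul, pow_two]
    abel
  rw [hfactor]
  exact ((rank_mul_le_left _ _).trans (rank_mul_le_right _ _)).trans hW

theorem mul_add_mem_arcDirections (X : Matrix (Fin n) (Fin n) ℝ) {K : Matrix (Fin n) (Fin q) ℝ}
    (hK : W.rank + K.rank ≤ r) : X * W + K ∈ arcDirections (rankSet n q r) W := by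
  refine ⟨0, fun t => ?_⟩
  have hfactor : W + t • (X * W + K) + t ^ 2 • (0 : Matrix (Fin n) (Fin q) ℝ) =
      (1 + t • X) * W + t • K := by
    simp [Matrix.add_mul, add_assoc]
  rw [hfactor]
  exact (rank_add_le _ _).trans
    ((add_le_add (rank_mul_le_right _ _) (rank_smul_le _ _)).trans hK)

/-- The regular normal cone of a set of matrices at `W` for the Frobenius inner product, the
matrix counterpart of `regularNormalCone`. -/
def frobNormalCone (S : Set (Matrix (Fin n) (Fin q) ℝ)) (W : Matrix (Fin n) (Fin q) ℝ) :
    Set (Matrix (Fin n) (Fin q) ℝ) :=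
  {N | ∀ ε : ℝ, 0 < ε →
    ∀ᶠ X in 𝓝[S] W, frobInner N (X - W) ≤ ε * √(frobInner (X - W) (X - W))}

theorem zero_mem_frobNormalCone {S : Set (Matrix (Fin n) (Fin q) ℝ)} :
    0 ∈ frobNormalCone S W := fun ε hε => .of_forall fun X => by
  rw [frobInner_zero_left]
  positivity

theorem frobInner_sub_eq_of_mul_mul_eq_self (hN : N * Wᵀ = 0) (hN' : Wᵀ * N = 0)
    {X : Matrix (Fin n) (Fin q) ℝ} {M : Matrix (Fin q) (Fin n) ℝ} (hX : X * M * X = X) :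
    frobInner N (X - W) = frobInner (N * (M * (X - W))ᵀ) (X - W) := by
  have hright : ∀ Y : Matrix (Fin n) (Fin n) ℝ, frobInner N (Y * W) = 0 := fun Y => by
    rw [frobInner_mul_eq_mul_transpose, hN, frobInner_zero_left]
  have hleft : ∀ Y : Matrix (Fin q) (Fin q) ℝ, frobInner N (W * Y) = 0 := fun Y => by
    rw [frobInner_mul_eq_transpose_mul, hN', frobInner_zero_left]
  have hsub : X - W = (X - W) * (M * (X - W)) + W * (M * (X - W)) + (X * M - 1) * W := by
    simp only [Matrix.mul_sub, Matrix.sub_mul, Matrix.one_mul, ← Matrix.mul_assoc, hX]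
    abel
  calc frobInner N (X - W)
      = frobInner N ((X - W) * (M * (X - W))) := by
        nth_rw 1 [hsub]
        rw [frobInner_add_right, frobInner_add_right, hleft, hright, add_zero, add_zero]
    _ = frobInner (N * (M * (X - W))ᵀ) (X - W) := frobInner_mul_eq_mul_transpose _ _ _

theorem mem_frobNormalCone_rankSet (hN : N * Wᵀ = 0) (hN' : Wᵀ * N = 0) (hW : W.rank = r) :
    N ∈ frobNormalCone (rankSet n q r) W := by
  intro ε hε
  obtain ⟨M, hM, hMX⟩ := exists_continuousAt_mul_mul_eq_self W
  have hsmall : ∀ᶠ X in 𝓝 W,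
      √(frobInner (N * (M X * (X - W))ᵀ) (N * (M X * (X - W))ᵀ)) < ε := by
    have hcont : Continuous fun Y : Matrix (Fin q) (Fin q) ℝ => √(frobInner (N * Yᵀ) (N * Yᵀ)) := by
      fun_prop
    have hZ : ContinuousAt (fun X => M X * (X - W)) W := by fun_prop
    refine (hcont.continuousAt.comp hZ).eventually_lt continuousAt_const ?_
    simpa [frobInner] using hε
  filter_upwards [nhdsWithin_le_nhds hsmall, nhdsWithin_le_nhds hMX, self_mem_nhdsWithin]
    with X hXε hXM hXr
  rw [frobInner_sub_eq_of_mul_mul_eq_self hN hN' (hXM (hW ▸ hXr))]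
  exact (frobInner_le_sqrt_mul_sqrt _ _).trans
    (mul_le_mul_of_nonneg_right hXε.le (Real.sqrt_nonneg _))

end RankSet

section SVD

open Matrix

variable {n q : ℕ} {W : Matrix (Fin n) (Fin q) ℝ} {U : Matrix (Fin n) (Fin n) ℝ}
  {σ : Fin (min n q) → ℝ} {V : Matrix (Fin q) (Fin q) ℝ}

/-- The diagonal matrix `Σ_Γ` of the nonzero singular values. -/
def gamDiagonal (σ : Fin (min n q) → ℝ) : Matrix (Gam σ) (Gam σ) ℝ :=
  diagonal fun k => σ k

theorem isUnit_det_gamDiagonal (σ : Fin (min n q) → ℝ) : IsUnit (gamDiagonal σ).det := by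
  rw [gamDiagonal, det_diagonal]
  exact (Finset.prod_ne_zero_iff.2 fun k _ => k.2).isUnit

theorem mul_rectDiagonal_apply_castLE {κ : Type*} (X : Matrix κ (Fin n) ℝ) (i : κ)
    (k : Fin (min n q)) :
    (X * rectDiagonal σ : Matrix κ (Fin q) ℝ) i (k.castLE (min_le_right n q)) =
      X i (k.castLE (min_le_left n q)) * σ k := by
  rw [mul_apply, Finset.sum_eq_single (k.castLE (min_le_left n q))]
  · simp [rectDiagonal]
  · intro a _ ha
    simp [rectDiagonal, show (a : ℕ) ≠ k from fun h => ha (Fin.ext h)]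
  · simp

theorem mul_transpose_rectDiagonal_apply_castLE {κ : Type*} (X : Matrix κ (Fin q) ℝ) (i : κ)
    (k : Fin (min n q)) :
    (X * (rectDiagonal σ)ᵀ : Matrix κ (Fin n) ℝ) i (k.castLE (min_le_left n q)) =
      X i (k.castLE (min_le_right n q)) * σ k := by
  rw [mul_apply, Finset.sum_eq_single (k.castLE (min_le_right n q))]
  · simp [rectDiagonal]
  · intro a _ ha
    simp [rectDiagonal, show (k : ℕ) ≠ a from fun h => ha (Fin.ext h.symm)]
  · simp

theorem IsSVD.mul_rightGam (h : IsSVD W U σ V) :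
    W * rightGam V σ = leftGam U σ * gamDiagonal σ := by
  have hWV : W * V = U * rectDiagonal σ := by
    rw [h.eq_mul, Matrix.mul_assoc, (mem_orthogonalGroup_iff' _ _).1 h.orthogonal_right,
      Matrix.mul_one]
  ext i k
  rw [gamDiagonal, mul_diagonal]
  exact (congrFun (congrFun hWV i) _).trans (mul_rectDiagonal_apply_castLE U i k.1)

theorem IsSVD.transpose_mul_leftGam (h : IsSVD W U σ V) :
    Wᵀ * leftGam U σ = rightGam V σ * gamDiagonal σ := by
  have hWU : Wᵀ * U = V * (rectDiagonal σ)ᵀ := by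
    rw [h.eq_mul, transpose_mul, transpose_mul, transpose_transpose, Matrix.mul_assoc,
      Matrix.mul_assoc, (mem_orthogonalGroup_iff' _ _).1 h.orthogonal_left, Matrix.mul_one]
  ext i k
  rw [gamDiagonal, mul_diagonal]
  exact (congrFun (congrFun hWU i) _).trans (mul_transpose_rectDiagonal_apply_castLE V i k.1)

theorem IsSVD.mul_rightGam_eq_zero (h : IsSVD W U σ V) {B : Matrix (Fin n) (Fin q) ℝ}
    (hB : B * Wᵀ = 0) : B * rightGam V σ = 0 := by
  have hdiag : B * rightGam V σ * gamDiagonal σ = 0 := by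
    rw [Matrix.mul_assoc, ← h.transpose_mul_leftGam, ← Matrix.mul_assoc, hB, Matrix.zero_mul]
  rw [← mul_nonsing_inv_cancel_right _ (B * rightGam V σ) (isUnit_det_gamDiagonal σ), hdiag,
    Matrix.zero_mul]

theorem IsSVD.transpose_leftGam_mul_eq_zero (h : IsSVD W U σ V) {B : Matrix (Fin n) (Fin q) ℝ}
    (hB : Wᵀ * B = 0) : (leftGam U σ)ᵀ * B = 0 := by
  have hdiag : Bᵀ * leftGam U σ * gamDiagonal σ = 0 := by
    rw [Matrix.mul_assoc, ← h.mul_rightGam, ← Matrix.mul_assoc, ← transpose_transpose W,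
      ← transpose_mul, hB, transpose_zero, Matrix.zero_mul]
  rw [← transpose_transpose B, ← transpose_mul,
    ← mul_nonsing_inv_cancel_right _ (Bᵀ * leftGam U σ) (isUnit_det_gamDiagonal σ), hdiag,
    Matrix.zero_mul, transpose_zero]

/-- `A ↦ matT U σ V A` as a linear map. -/
noncomputable def matTLinearMap (U : Matrix (Fin n) (Fin n) ℝ) (σ : Fin (min n q) → ℝ)
    (V : Matrix (Fin q) (Fin q) ℝ) : Matrix (Fin n) (Fin q) ℝ →ₗ[ℝ]
      Matrix (Gam σ ⊕ GamRowCompl σ) (Gam σ ⊕ GamColCompl σ) ℝ where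
  toFun := matT U σ V
  map_add' X Y := by simp [matT, fromBlocks_add, Matrix.mul_add, Matrix.add_mul]
  map_smul' c X := by simp [matT, fromBlocks_smul]

/-- `A ↦ matR U σ V A` as a linear map. -/
noncomputable def matRLinearMap (U : Matrix (Fin n) (Fin n) ℝ) (σ : Fin (min n q) → ℝ)
    (V : Matrix (Fin q) (Fin q) ℝ) :
    Matrix (Fin n) (Fin q) ℝ →ₗ[ℝ] Matrix (Fin n) (Gam σ) ℝ where
  toFun := matR U σ V
  map_add' X Y := by simp [matR, Matrix.mul_add, Matrix.add_mul]
  map_smul' c X := by simp [matR]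

variable {S : Submodule ℝ (Matrix (Fin n) (Fin q) ℝ)} {B : Matrix (Fin n) (Fin q) ℝ}

theorem mul_transpose_eq_zero_of_dualRestrict_eq_zero
    (hS : (mulRightLinearMap (Fin n) ℝ W).range ≤ S) (hB : S.dualRestrict (frobForm B) = 0) :
    B * Wᵀ = 0 :=
  eq_zero_of_forall_frobInner_eq_zero fun X => by
    rw [← frobInner_mul_eq_mul_transpose]
    exact LinearMap.congr_fun hB ⟨X * W, hS ⟨X, rfl⟩⟩

theorem transpose_mul_eq_zero_of_dualRestrict_eq_zero
    (hS : (mulLeftLinearMap (Fin q) ℝ W).range ≤ S) (hB : S.dualRestrict (frobForm B) = 0) :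
    Wᵀ * B = 0 :=
  eq_zero_of_forall_frobInner_eq_zero fun Y => by
    rw [← frobInner_mul_eq_transpose_mul]
    exact LinearMap.congr_fun hB ⟨W * Y, hS ⟨Y, rfl⟩⟩

/-- The matrices `X * W + W * Y`, which form the tangent space at `W` to the matrices of rank
`W.rank`. -/
def rankTangentSpace (W : Matrix (Fin n) (Fin q) ℝ) : Submodule ℝ (Matrix (Fin n) (Fin q) ℝ) :=
  (mulRightLinearMap (Fin n) ℝ W).range ⊔ (mulLeftLinearMap (Fin q) ℝ W).range

variable {ι : Type*} {A : ι → Matrix (Fin n) (Fin q) ℝ}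

theorem linearIndependent_dualRestrict_mono {T : Submodule ℝ (Matrix (Fin n) (Fin q) ℝ)}
    (hA : LinearIndependent ℝ fun i => S.dualRestrict (frobForm (A i))) (hST : S ≤ T) :
    LinearIndependent ℝ fun i => T.dualRestrict (frobForm (A i)) :=
  linearIndependent_comp_of_ker_le (f := T.dualRestrict ∘ₗ frobForm)
    (g := S.dualRestrict ∘ₗ frobForm) hA fun _ hB =>
      LinearMap.ext fun H => LinearMap.congr_fun hB ⟨H, hST H.2⟩

theorem IsSVD.linearIndependent_dualRestrict_of_matT (h : IsSVD W U σ V)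
    (hA : LinearIndependent ℝ fun i => matT U σ V (A i)) :
    LinearIndependent ℝ fun i => (rankTangentSpace W).dualRestrict (frobForm (A i)) := by
  refine linearIndependent_comp_of_ker_le (f := (rankTangentSpace W).dualRestrict ∘ₗ frobForm)
    (g := matTLinearMap U σ V) hA fun B hB => ?_
  have hleft := h.transpose_leftGam_mul_eq_zero
    (transpose_mul_eq_zero_of_dualRestrict_eq_zero le_sup_right hB)
  have hright := h.mul_rightGam_eq_zero
    (mul_transpose_eq_zero_of_dualRestrict_eq_zero le_sup_left hB)
  change matT U σ V B = 0
  simp [matT, hleft, hright, Matrix.mul_assoc]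

theorem IsSVD.linearIndependent_dualRestrict_of_matR (h : IsSVD W U σ V)
    (hA : LinearIndependent ℝ fun i => matR U σ V (A i)) :
    LinearIndependent ℝ fun i =>
      (mulRightLinearMap (Fin n) ℝ W).range.dualRestrict (frobForm (A i)) := by
  set S := (mulRightLinearMap (Fin n) ℝ W).range
  refine linearIndependent_comp_of_ker_le (f := S.dualRestrict ∘ₗ frobForm)
    (g := matRLinearMap U σ V) hA fun B hB => ?_
  change matR U σ V B = 0
  rw [matR, Matrix.mul_assoc, h.mul_rightGam_eq_zero
    (mul_transpose_eq_zero_of_dualRestrict_eq_zero le_rfl hB), Matrix.mul_zero]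

end SVD

section KKT

open Matrix

variable {n q m r : ℕ} {A : Fin m → Matrix (Fin n) (Fin q) ℝ} {β : ℝ}
  {W : Matrix (Fin n) (Fin q) ℝ} {z : Fin m → ℝ}

theorem isKKTPoint_of_neg_mem_frobNormalCone (hβ : 0 < β) (hfeas : (W, z) ∈ feasibleSet A r)
    {s : Fin m → ℝ} (hs : s ∈ heavisideSubgradients z)
    (hnormal : -(W + ∑ i, s i • A i) ∈ frobNormalCone (rankSet n q r) W) :
    IsKKTPoint A β r (W, z) := by
  refine ⟨s, ⟨_, mem_regularSubdifferential_lagrangian hβ hs, hfeas, fun ε hε => ?_⟩,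
    hfeas.2, sub_eq_zero.2 hfeas.1⟩
  have hfst : Filter.Tendsto Prod.fst (𝓝[feasibleSet A r] (W, z)) (𝓝[rankSet n q r] W) :=
    tendsto_nhdsWithin_of_tendsto_nhds_of_eventually_within _
      ((continuous_fst.tendsto (W, z)).mono_left nhdsWithin_le_nhds)
      (eventually_mem_nhdsWithin.mono fun _ hy => hy.2)
  filter_upwards [hfst.eventually (hnormal ε hε)] with y hy
  simpa [pairInner] using
    hy.trans (mul_le_mul_of_nonneg_left (sqrt_frobInner_le_pairNorm (y - (W, z))) hε.le)

theorem IsLocalMinimizer.exists_multiplier (hβ : 0 ≤ β) (hmin : IsLocalMinimizer A β r (W, z))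
    {S : Submodule ℝ (Matrix (Fin n) (Fin q) ℝ)} (hS : ↑S ⊆ arcDirections (rankSet n q r) W)
    (hA : LinearIndependent ℝ fun i => S.dualRestrict (frobForm (A i))) :
    ∃ s ∈ heavisideSubgradients z, S.dualRestrict (frobForm (W + ∑ i, s i • A i)) = 0 := by
  obtain ⟨s, hs, hsz, hsum⟩ :=
    exists_multiplier_of_isLocalMinOn (hmin.isLocalMinOn_frobInner hβ) hS hA
  exact ⟨s, ⟨hs, hsz⟩, hsum⟩

variable {U : Matrix (Fin n) (Fin n) ℝ} {σ : Fin (min n q) → ℝ} {V : Matrix (Fin q) (Fin q) ℝ}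

theorem IsLocalMinimizer.isKKTPoint_of_rank_eq (hβ : 0 < β)
    (hmin : IsLocalMinimizer A β r (W, z)) (hsvd : IsSVD W U σ V) (hrank : W.rank = r)
    (hT : LinearIndependent ℝ fun i => matT U σ V (A i)) : IsKKTPoint A β r (W, z) := by
  have harc : ↑(rankTangentSpace W) ⊆ arcDirections (rankSet n q r) W := by
    intro H hH
    obtain ⟨_, ⟨X, rfl⟩, _, ⟨Y, rfl⟩, rfl⟩ := Submodule.mem_sup.1 hH
    exact mul_add_mul_mem_arcDirections hrank.le X Y
  obtain ⟨s, hs, hsum⟩ := hmin.exists_multiplier hβ.le harc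
    (hsvd.linearIndependent_dualRestrict_of_matT hT)
  refine isKKTPoint_of_neg_mem_frobNormalCone hβ hmin.1 hs (mem_frobNormalCone_rankSet ?_ ?_ hrank)
  · rw [Matrix.neg_mul, mul_transpose_eq_zero_of_dualRestrict_eq_zero le_sup_left hsum, neg_zero]
  · rw [Matrix.mul_neg, transpose_mul_eq_zero_of_dualRestrict_eq_zero le_sup_right hsum, neg_zero]

theorem IsLocalMinimizer.exists_multiplier_of_rank_add_le (hβ : 0 ≤ β)
    (hmin : IsLocalMinimizer A β r (W, z))
    (hA : LinearIndependent ℝ fun i =>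
      (mulRightLinearMap (Fin n) ℝ W).range.dualRestrict (frobForm (A i)))
    {K : Matrix (Fin n) (Fin q) ℝ} (hK : W.rank + K.rank ≤ r) :
    ∃ s ∈ heavisideSubgradients z, frobInner (W + ∑ i, s i • A i) K = 0 ∧
      (mulRightLinearMap (Fin n) ℝ W).range.dualRestrict (frobForm (W + ∑ i, s i • A i)) = 0 := by
  set S := (mulRightLinearMap (Fin n) ℝ W).range
  have harc : ↑(S ⊔ ℝ ∙ K) ⊆ arcDirections (rankSet n q r) W := by
    intro H hH
    obtain ⟨_, ⟨X, rfl⟩, K', hK', rfl⟩ := Submodule.mem_sup.1 hH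
    obtain ⟨c, rfl⟩ := Submodule.mem_span_singleton.1 hK'
    exact mul_add_mem_arcDirections X (le_trans (by gcongr; exact rank_smul_le c K) hK)
  obtain ⟨s, hs, hsum⟩ := hmin.exists_multiplier hβ harc
    (linearIndependent_dualRestrict_mono hA le_sup_left)
  exact ⟨s, hs,
    LinearMap.congr_fun hsum ⟨K, Submodule.mem_sup_right (Submodule.mem_span_singleton_self K)⟩,
    LinearMap.ext fun H => LinearMap.congr_fun hsum ⟨H, Submodule.mem_sup_left H.2⟩⟩

theorem IsLocalMinimizer.isKKTPoint_of_rank_lt (hβ : 0 < β)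
    (hmin : IsLocalMinimizer A β r (W, z)) (hsvd : IsSVD W U σ V) (hrank : W.rank < r)
    (hR : LinearIndependent ℝ fun i => matR U σ V (A i)) : IsKKTPoint A β r (W, z) := by
  set S := (mulRightLinearMap (Fin n) ℝ W).range
  have hA : LinearIndependent ℝ fun i => S.dualRestrict (frobForm (A i)) :=
    hsvd.linearIndependent_dualRestrict_of_matR hR
  have hunique : ∀ s s' : Fin m → ℝ, S.dualRestrict (frobForm (W + ∑ i, s i • A i)) = 0 →
      S.dualRestrict (frobForm (W + ∑ i, s' i • A i)) = 0 → s = s' := by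
    intro s s' hs hs'
    refine hA.fintypeLinearCombination_injective ?_
    rw [← hs', map_add, map_add, map_add, map_add, add_right_inj] at hs
    simpa [Fintype.linearCombination_apply] using hs
  obtain ⟨s, hs, -, hsum⟩ := hmin.exists_multiplier_of_rank_add_le hβ.le hA (K := 0)
    (by simpa using hrank.le)
  have hstat : W + ∑ l, s l • A l = 0 := by
    ext i j
    have hK : (single i j (1 : ℝ)).rank ≤ 1 := by
      rw [single_eq_single_vecMulVec_single]
      exact rank_vecMulVec_le _ _
    obtain ⟨s', -, hs'K, hs'⟩ := hmin.exists_multiplier_of_rank_add_le hβ.le hA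
      ((Nat.add_le_add_left hK _).trans hrank)
    rwa [← hunique s s' hsum hs', frobInner_single_right] at hs'K
  refine isKKTPoint_of_neg_mem_frobNormalCone hβ hmin.1 hs ?_
  rw [hstat, neg_zero]
  exact zero_mem_frobNormalCone

end KKT

end HLSMM

theorem mainTheorem1_general {n q m r : ℕ} {A : Fin m → Matrix (Fin n) (Fin q) ℝ} {β : ℝ}
    (hβ : 0 < β) {W : Matrix (Fin n) (Fin q) ℝ} {z : Fin m → ℝ} {U : Matrix (Fin n) (Fin n) ℝ}
    {σ : Fin (min n q) → ℝ} {V : Matrix (Fin q) (Fin q) ℝ} (hsvd : HLSMM.IsSVD W U σ V)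
    (hcq : HLSMM.ConstraintQualification A r W U σ V)
    (hmin : HLSMM.IsLocalMinimizer A β r (W, z)) :
    HLSMM.IsKKTPoint A β r (W, z) := by
  rcases (show W.rank ≤ r from hmin.1.2).eq_or_lt with hrank | hrank
  · exact hmin.isKKTPoint_of_rank_eq hβ hsvd hrank (hcq.1 hrank)
  · exact hmin.isKKTPoint_of_rank_lt hβ hsvd hrank (hcq.2 hrank)

theorem mainTheorem1 (p q m r : ℕ) (hr : 0 < r) (hrpq : r < min p q)
    (A : Fin m → Matrix (Fin (p + 1)) (Fin q) ℝ) (β : ℝ) (hβ : 0 < β)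
    (W : Matrix (Fin (p + 1)) (Fin q) ℝ) (z : Fin m → ℝ)
    (U : Matrix (Fin (p + 1)) (Fin (p + 1)) ℝ) (σ : Fin (min (p + 1) q) → ℝ)
    (V : Matrix (Fin q) (Fin q) ℝ) (hsvd : HLSMM.IsSVD W U σ V)
    (hcq : HLSMM.ConstraintQualification A r W U σ V)
    (hmin : HLSMM.IsLocalMinimizer A β r (W, z)) :
    HLSMM.IsKKTPoint A β r (W, z) :=
  mainTheorem1_general hβ hsvd hcq hmin
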